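/- \textbf{Definitions.} An \emph{oriented abelian group} is an abelian group $A$ with a strict cyclic ternary relation $\mathcal{O}$ (that is, $\mathcal{O}(a,b,c)$ implies $\mathcal{O}(b,c,a)$ and that $a,b,c$ are pairwise distinct) which is invariant under translations and such that $x<_0y :\Leftrightarrow x\neq y\wedge\mathcal{O}(0,x,y)$ is a strict linear order on $A\setminus\{0\}$. It is \emph{regularly dense} if for each prime $p$ and all $a,b\in A$ with $\mathcal{O}(0,a,b)$ there is $c\in A$ with $\mathcal{O}(a,pc,b)$ and $ic<_0(i+1)c$ for all $i\in\{1,\dots,p-1\}$. Write $[p]A=|A/pA|$ (all infinite cardinalities being identified), and let $e(A,p)\in\mathbb{N}\cup\{\infty\}$ be the least $e$ such that $\{x: p^{e+k}x=0\}=\{x:p^{e}x=0\}$ for all $k\in\mathbb{N}$, or $\infty$ if there is no such $e$. For sequences $\vec d,\vec e$ in $\mathbb{N}\cup\{\infty\}$ indexed by the primes, the models of $T(\vec d,\vec e)$ are the regularly dense oriented abelian groups $A$ with $[p]A=p^{d_p}$ and $e(A,p)=e_p$ for every prime $p$. The models of $T\big((\vec d_1,\vec e_1),(\vec d_2,\vec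 e_2)\big)$, in the language $\{+,-,0,\mathcal{O},V\}$, are the pairs $(A,G)$ such that $A\models T(\vec d_1,\vec e_1)$, $V$ is interpreted as a subgroup $G$ of $A$ with $G\models T(\vec d_2,\vec e_2)$ for the induced orientation, $G$ is dense in $A$ (every nonempty orientation interval $\{x:\mathcal{O}(a,x,b)\}$ of $A$ meets $G$), and $A/G$ is infinite. For a partitioned formula $\psi(\vec x;\vec y)$ and a structure $M$, put $\psi(M;\vec b)=\{\vec a\in M^{|\vec x|}: M\models\psi(\vec a;\vec b)\}$, let $\pi_\psi(n)$ be the maximum, over all $n$-element sets $B\subseteq M^{|\vec x|}$, of the number of sets of the form $B\cap\psi(M;\vec b)$ with $\vec b\in M^{|\vec y|}$, and let the \emph{VC-density} $\operatorname{vc}(\psi)\in[0,\infty]$ be the infimum of all real $r\ge 0$ with $\pi_\psi(n)=O(n^r)$ as $n\to\infty$. \textbf{Proposition.} Let $(A,G)$ be a model of one of the theories $$T\big((\vec 0,\vec 0),(\vec 0,\vec 0)\big),\qquad T\big((\vec 0,\vec\infty),(\vec 0,\vec 0)\big),\qquad T\big((\vec 0,\vec\infty),(\vec 0,\vec\infty)\big),$$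 and let $\sigma(x;y)$ be the formula $\mathcal{O}(y,x,2y)\vee V(x-y)$, with single object variable $x$ and single parameter variable $y$. Then the following hold. \begin{enumerate} \item $\sigma$ has VC-density exactly $2$ in $(A,G)$. \item Consequently, no uniform upper bound better than $2|\vec y|$ is possible: if $c\in[0,\infty]$ is such that $\operatorname{vc}(\psi)\le c\,|\vec y|$ in $(A,G)$ for all partitioned formulas $\psi(\vec x;\vec y)$ of the language, then $c\ge 2$. \item For every $k\in\mathbb{N}$ there is a set $B\subseteq A$ with exactly $k$ elements such that every subset of $B$ with at most two elements is of the form $B\cap\sigma(A;b)$ for some $b\in A$. \end{enumerate} -/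

import Mathlib

open Filter Asymptotics FirstOrder FirstOrder.Language
open scoped ENNReal NNReal

namespace OrientedPairs

/-! ### Shatter function and VC-density -/

section VC

/-- The traces `s ∩ B`, for `s ∈ S`, of a set system `S` on a finite set `B`. -/
def traces {X : Type*} (S : Set (Set X)) (B : Finset X) : Set (Set X) :=
  (fun s => s ∩ (B : Set X)) '' S

/-- The shatter function `π_S`: the maximal number of traces of `S` on an `n`-element set. -/
noncomputable def shatterFunction {X : Type*} (S : Set (Set X)) (n : ℕ) : ℕ :=
  sSup {m : ℕ | ∃ B : Finset X, B.card = n ∧ m = (traces S B).ncard}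

/-- The numbers over which the shatter function takes a supremum are bounded by `2 ^ n`,
so that the supremum is a genuine maximum. -/
theorem bddAbove_traces {X : Type*} (S : Set (Set X)) (n : ℕ) :
    BddAbove {m : ℕ | ∃ B : Finset X, B.card = n ∧ m = (traces S B).ncard} := by
  refine ⟨2 ^ n, ?_⟩
  rintro m ⟨B, hB, rfl⟩
  have h : traces S B ⊆ 𝒫 (B : Set X) := by
    rintro _ ⟨s, -, rfl⟩
    exact Set.inter_subset_right
  calc (traces S B).ncard ≤ (𝒫 (B : Set X)).ncard :=
        Set.ncard_le_ncard h (B.finite_toSet.finite_subsets)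
    _ = 2 ^ n := by rw [Set.ncard_powerset _ B.finite_toSet, Set.ncard_coe_finset, hB]

/-- The VC-density of a set system: the infimum of all `r ≥ 0` with `π_S(n) = O(n ^ r)`
(and `∞` if there is no such `r`). -/
noncomputable def setVCDensity {X : Type*} (S : Set (Set X)) : ℝ≥0∞ :=
  ⨅ (r : ℝ≥0) (_ : (fun n : ℕ => (shatterFunction S n : ℝ)) =O[atTop]
    (fun n : ℕ => (n : ℝ) ^ (r : ℝ))), (r : ℝ≥0∞)

variable {L : Language} (M : Type*) [L.Structure M] {m n : ℕ}

/-- `ψ(M; b)`: the set defined by the partitioned formula `ψ(x; y)` (object variables indexed by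
`Fin m`, parameter variables by `Fin n`) at the parameter tuple `b`. -/
def definedSet (ψ : L.Formula (Fin m ⊕ Fin n)) (b : Fin n → M) : Set (Fin m → M) :=
  {a | ψ.Realize (Sum.elim a b)}

/-- The set system `{ψ(M; b) : b ∈ M ^ n}`. -/
def formulaFamily (ψ : L.Formula (Fin m ⊕ Fin n)) : Set (Set (Fin m → M)) :=
  Set.range (definedSet M ψ)

/-- The VC-density `vc(ψ)` of a partitioned formula in the structure `M`. -/
noncomputable def vcDensity (ψ : L.Formula (Fin m ⊕ Fin n)) : ℝ≥0∞ :=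
  setVCDensity (formulaFamily M ψ)

end VC

/-! ### Oriented abelian groups -/

section Oriented

variable {A : Type*} [AddCommGroup A]

/-- `x <₀ y`. -/
def lt₀ (O : A → A → A → Prop) (x y : A) : Prop := x ≠ y ∧ O 0 x y

/-- `O` is an orientation on the abelian group `A`: a (strict) cyclic ternary relation preserved by
translations, such that `<₀` is a strict linear order on `A \ {0}`.
(Irreflexivity of `<₀` is built into its definition.) -/
structure IsOrientation (O : A → A → A → Prop) : Prop where
  cyclic : ∀ a b c, O a b c → O b c a
  strict : ∀ a b c, O a b c → a ≠ b ∧ b ≠ c ∧ a ≠ c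
  add_right : ∀ a b c d, O a b c → O (a + d) (b + d) (c + d)
  trans : ∀ x y z, x ≠ 0 → y ≠ 0 → z ≠ 0 → lt₀ O x y → lt₀ O y z → lt₀ O x z
  total : ∀ x y, x ≠ 0 → y ≠ 0 → x ≠ y → lt₀ O x y ∨ lt₀ O y x

/-- Regular density. -/
def IsRegularlyDense (O : A → A → A → Prop) : Prop :=
  ∀ p : ℕ, p.Prime → ∀ a b : A, O 0 a b →
    ∃ c : A, O a (p • c) b ∧ ∀ i ∈ Finset.Icc 1 (p - 1), lt₀ O (i • c) ((i + 1) • c)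

variable (A)

/-- `[p]A`, the cardinality of `A / pA` (with all infinite cardinalities identified). -/
noncomputable def divIndex (p : ℕ) : ℕ∞ :=
  ENat.card (A ⧸ (nsmulAddMonoidHom p : A →+ A).range)

/-- The subgroup of elements of `A` killed by `n`. -/
def tor (n : ℕ) : AddSubgroup A := (nsmulAddMonoidHom n : A →+ A).ker

/-- `e(A,p)`: the least `e` at which the chain `Tor_{p^0}(A) ≤ Tor_{p^1}(A) ≤ ⋯` becomes
stationary, and `∞` if it never does. -/
noncomputable def torsionInvariant (p : ℕ) : ℕ∞ :=
  ⨅ (e : ℕ) (_ : ∀ k : ℕ, tor A (p ^ (e + k)) = tor A (p ^ e)), (e : ℕ∞)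

/-- `p ^ d` for `d ∈ ℕ ∪ {∞}`, with `p ^ ∞ = ∞`. -/
def extPow (p : ℕ) : ℕ∞ → ℕ∞
  | none => ⊤
  | some d => ((p ^ d : ℕ) : ℕ∞)

variable {A}

/-- `(A, +, -, 0, O)` is a model of `T(d, e)`, for sequences `d`, `e` in `ℕ ∪ {∞}` indexed by the
primes. -/
structure IsModel (O : A → A → A → Prop) (d e : Nat.Primes → ℕ∞) : Prop where
  orientation : IsOrientation O
  regularlyDense : IsRegularlyDense O
  divIndex_eq : ∀ p : Nat.Primes, divIndex A p = extPow p (d p)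
  torsionInvariant_eq : ∀ p : Nat.Primes, torsionInvariant A p = e p

/-- `(A, G)` is a model of the pair theory `T((d₁, e₁), (d₂, e₂))`: `A` is a model of `T(d₁, e₁)`,
the subgroup `G`, with the induced orientation, is a model of `T(d₂, e₂)`, `G` is dense in `A`
(it meets every nonempty orientation interval), and `A / G` is infinite. -/
structure IsPairModel (O : A → A → A → Prop) (G : AddSubgroup A)
    (d₁ e₁ d₂ e₂ : Nat.Primes → ℕ∞) : Prop where
  model : IsModel O d₁ e₁
  submodel : IsModel (fun a b c : G => O a b c) d₂ e₂
  dense : ∀ a b : A, {x | O a x b}.Nonempty → ∃ g ∈ G, O a g b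
  infinite : Infinite (A ⧸ G)

end Oriented

/-! ### The language of pairs -/

/-- Function symbols `+`, `-` (unary), `0`. -/
inductive PairFunc : ℕ → Type
  | add : PairFunc 2
  | neg : PairFunc 1
  | zero : PairFunc 0

/-- Relation symbols: the ternary `O` and the unary `V`. -/
inductive PairRel : ℕ → Type
  | orient : PairRel 3
  | dist : PairRel 1

/-- The language `{+, -, 0, O, V}` of pairs of oriented abelian groups. -/
def pairLanguage : Language := ⟨PairFunc, PairRel⟩

/-- The structure `(A, G)`: the abelian group `A` with `O` interpreted as the orientation and `V`
as membership in `G`. -/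
@[reducible] def pairStructure {A : Type*} [AddCommGroup A] (O : A → A → A → Prop) (G : AddSubgroup A) :
    pairLanguage.Structure A where
  funMap := fun {_} f =>
    match f with
    | PairFunc.add => fun v => v 0 + v 1
    | PairFunc.neg => fun v => - v 0
    | PairFunc.zero => fun _ => 0
  RelMap := fun {_} r =>
    match r with
    | PairRel.orient => fun v => O (v 0) (v 1) (v 2)
    | PairRel.dist => fun v => v 0 ∈ G

section Terms

variable {α : Type*}

/-- The term `s + t`. -/
def addTerm (s t : pairLanguage.Term α) : pairLanguage.Term α :=
  Functions.apply₂ (L := pairLanguage) PairFunc.add s t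

/-- The term `- t`. -/
def negTerm (t : pairLanguage.Term α) : pairLanguage.Term α :=
  Functions.apply₁ (L := pairLanguage) PairFunc.neg t

/-- The formula `O(s, t, u)`. -/
def orientFormula (s t u : pairLanguage.Term α) : pairLanguage.Formula α :=
  Relations.formula (L := pairLanguage) PairRel.orient ![s, t, u]

/-- The formula `V(t)`. -/
def distFormula (t : pairLanguage.Term α) : pairLanguage.Formula α :=
  Relations.formula (L := pairLanguage) PairRel.dist ![t]

end Terms

/-- The partitioned formula `σ(x; y) : O(y, x, 2y) ∨ V(x - y)`. -/
def sigmaFormula : pairLanguage.Formula (Fin 1 ⊕ Fin 1) :=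
  let x : pairLanguage.Term (Fin 1 ⊕ Fin 1) := Term.var (Sum.inl 0)
  let y : pairLanguage.Term (Fin 1 ⊕ Fin 1) := Term.var (Sum.inr 0)
  orientFormula y x (addTerm y y) ⊔ distFormula (addTerm x (negTerm y))

/-- The formula `σ` means what it should in the structure `(A, G)`. -/
theorem mem_definedSet_sigmaFormula {A : Type*} [AddCommGroup A] (O : A → A → A → Prop)
    (G : AddSubgroup A) (a b : Fin 1 → A) :
    letI := pairStructure O G
    a ∈ definedSet A sigmaFormula b ↔ O (b 0) (a 0) ((2 : ℕ) • b 0) ∨ a 0 - b 0 ∈ G := by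
  rw [two_nsmul, sub_eq_add_neg]
  simp only [definedSet, sigmaFormula, Set.mem_ofPred_eq, Formula.realize_sup, orientFormula,
    distFormula]
  exact Iff.rfl

end OrientedPairs

/-! Read `x <₀ y` as "x comes before y when travelling from `0` round the circle".

Upper bound: a trace of `σ(A; b)` is the union of a trace of the interval `(b, 2b)` and a trace of
the coset `b + G`. The coset traces on `n` points number at most `n + 1`. Doubling is monotone on
the half circle where `b <₀ 2b` and again on the other half, so on each half both endpoints move
forward with `b`. The interval traces then come from two chains, at most `4n + 3` in all
(`ncard_interval_traces_le`), and the product is quadratic in `n`.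

Lower bound: choose points `x n` shrinking towards `0`, in pairwise distinct cosets of `G`, so
spaced that some `b` just before `x n` has `x n` as the only point of the sequence in `(b, 2b)`.
These `b` fill an interval, so by density of `G` one of them lies in the coset of `x j`, and `σ(A;
b)` cuts out exactly `{x n, x j}` (`exists_sequence`). This gives at least `n.choose 2` traces. -/

open Finset in
/-- A finite family of pairs of subsets of an `n`-element set that forms a chain for the
componentwise inclusion has at most `2 * n + 1` members. -/
theorem ncard_image_le_of_chain {X Y Z : Type*} (B : Finset X) (S : Set Y) (f g : Y → Finset X)
    (hf : ∀ y, f y ⊆ B) (hg : ∀ y, g y ⊆ B)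
    (chain : ∀ y ∈ S, ∀ y' ∈ S, (f y ⊆ f y' ∧ g y ⊆ g y') ∨ (f y' ⊆ f y ∧ g y' ⊆ g y))
    (F : Finset X → Finset X → Z) :
    ((fun y => F (f y) (g y)) '' S).Finite ∧
      ((fun y => F (f y) (g y)) '' S).ncard ≤ 2 * #B + 1 := by
  have hfin : ((fun y => (f y, g y)) '' S).Finite := by
    refine (B.powerset ×ˢ B.powerset).finite_toSet.subset ?_
    rintro _ ⟨y, -, rfl⟩
    simp [hf, hg]
  have hcard : ((fun y => (f y, g y)) '' S).ncard ≤ 2 * #B + 1 := by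
    -- Along a chain the sum of the two cardinalities determines the pair, and it takes values in
    -- `0, …, 2 * #B`.
    have := Set.ncard_le_ncard_of_injOn (s := (fun y => (f y, g y)) '' S)
      (t := (Finset.range (2 * #B + 1) : Set ℕ)) (fun p => #p.1 + #p.2) ?_ ?_
      (Finset.finite_toSet _)
    · simpa using this
    · rintro _ ⟨y, -, rfl⟩
      have h₁ := card_le_card (hf y)
      have h₂ := card_le_card (hg y)
      simp only [coe_range, Set.mem_Iio]
      omega
    · have key : ∀ y y', f y ⊆ f y' → g y ⊆ g y' → #(f y) + #(g y) = #(f y') + #(g y') →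
          (f y, g y) = (f y', g y') := by
        intro y y' h₁ h₂ h
        have h₃ := card_le_card h₁
        have h₄ := card_le_card h₂
        rw [eq_of_subset_of_card_le h₁ (by omega), eq_of_subset_of_card_le h₂ (by omega)]
      rintro _ ⟨y, hy, rfl⟩ _ ⟨y', hy', rfl⟩ h
      rcases chain y hy y' hy' with ⟨h₁, h₂⟩ | ⟨h₁, h₂⟩
      · exact key y y' h₁ h₂ h
      · exact (key y' y h₁ h₂ h.symm).symm
  have himage : (fun y => F (f y) (g y)) '' S
      = (fun p : Finset X × Finset X => F p.1 p.2) '' ((fun y => (f y, g y)) '' S) := by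
    rw [Set.image_image]
  rw [himage]
  exact ⟨hfin.image _, (Set.ncard_image_le hfin).trans hcard⟩

/-! ### Arithmetic of orientations: negation and doubling. -/

namespace OrientedPairs

namespace IsOrientation

variable {A : Type*} [AddCommGroup A] {O : A → A → A → Prop}

theorem of_add_right (h : IsOrientation O) {a b c : A} (d : A)
    (H : O (a + d) (b + d) (c + d)) : O a b c := by
  simpa using h.add_right _ _ _ (-d) H

theorem trans_zero (h : IsOrientation O) {x y z : A} (h₁ : O 0 x y) (h₂ : O 0 y z) :
    O 0 x z := by
  have s₁ := h.strict _ _ _ h₁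
  have s₂ := h.strict _ _ _ h₂
  exact (h.trans x y z s₁.1.symm s₁.2.2.symm s₂.2.2.symm ⟨s₁.2.1, h₁⟩ ⟨s₂.2.1, h₂⟩).2

theorem irrefl_zero (h : IsOrientation O) {x : A} : ¬ O 0 x x :=
  fun H => (h.strict _ _ _ H).2.1 rfl

theorem asymm_zero (h : IsOrientation O) {x y : A} (h₁ : O 0 x y) : ¬ O 0 y x :=
  fun h₂ => h.irrefl_zero (h.trans_zero h₁ h₂)

theorem total_zero (h : IsOrientation O) {x y : A} (hx : x ≠ 0) (hy : y ≠ 0) (hxy : x ≠ y) :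
    O 0 x y ∨ O 0 y x :=
  (h.total x y hx hy hxy).imp (fun H => H.2) (fun H => H.2)

theorem trans_left (h : IsOrientation O) {a b c d : A} (h₁ : O a b c) (h₂ : O a c d) :
    O a b d := by
  have h₁' := h.add_right _ _ _ (-a) h₁
  have h₂' := h.add_right _ _ _ (-a) h₂
  rw [add_neg_cancel] at h₁' h₂'
  refine h.of_add_right (-a) ?_
  rw [add_neg_cancel]
  exact h.trans_zero h₁' h₂'

theorem cyclic' (h : IsOrientation O) {a b c : A} (H : O a b c) : O c a b :=
  h.cyclic _ _ _ (h.cyclic _ _ _ H)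

theorem trans_right (h : IsOrientation O) {a b c d : A} (h₁ : O a b c) (h₂ : O a c d) :
    O b c d :=
  h.cyclic' (h.trans_left (h.cyclic _ _ _ h₂) (h.cyclic' h₁))

theorem between_zero (h : IsOrientation O) {a x b : A} (h₁ : O 0 a b) (h₂ : O a x b) :
    O 0 a x ∧ O 0 x b :=
  ⟨h.trans_right (h.cyclic' h₁) (h.cyclic' h₂),
    h.cyclic _ _ _ (h.trans_left (h.cyclic' h₁) (h.cyclic' h₂))⟩

theorem translate (h : IsOrientation O) (d : A) {a b c a' b' c' : A} (H : O a b c)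
    (ha : a + d = a') (hb : b + d = b') (hc : c + d = c') : O a' b' c' := by
  subst ha hb hc
  exact h.add_right _ _ _ _ H

theorem neg_lt_sub (h : IsOrientation O) {x y : A} (H : O 0 x y) : O 0 (-y) (x - y) :=
  h.cyclic' (h.translate (-y) H (by abel) (by abel) (by abel))

theorem sub_lt_neg (h : IsOrientation O) {x y : A} (H : O 0 x y) : O 0 (y - x) (-x) :=
  h.cyclic _ _ _ (h.translate (-x) H (by abel) (by abel) (by abel))

theorem neg_lt_neg (h : IsOrientation O) {x y : A} (H : O 0 x y) : O 0 (-y) (-x) := by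
  have s := h.strict _ _ _ H
  refine (h.total_zero (neg_ne_zero.2 s.2.2.symm) (neg_ne_zero.2 s.1.symm)
    (fun e => s.2.1 (neg_injective e).symm)).resolve_right fun H' => ?_
  have h₁ := h.sub_lt_neg H'
  simp only [neg_neg, sub_neg_eq_add, neg_add_eq_sub] at h₁
  -- If `-x <₀ -y` held, there would be a cycle `-x < -y < x - y < x < y < y - x < -x`.
  exact h.irrefl_zero (h.trans_zero H' (h.trans_zero (h.neg_lt_sub H) (h.trans_zero h₁
    (h.trans_zero H (h.trans_zero (by
      simpa only [neg_neg, neg_add_eq_sub, sub_neg_eq_add] using h.neg_lt_sub H')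
      (h.sub_lt_neg H))))))

/-- Translation by `-x` takes `(0, x, 2x)` to `(-x, 0, x)`, a rotation of `(0, x, -x)`. This
condition marks the first half circle. -/
theorem lt_double_iff (h : IsOrientation O) {x : A} : O 0 x (x + x) ↔ O 0 x (-x) :=
  ⟨fun H => h.cyclic _ _ _ (h.translate (-x) H (by abel) (by abel) (by abel)),
    fun H => h.translate x (h.cyclic' H) (by abel) (by abel) (by abel)⟩

theorem lt_double_of_lt (h : IsOrientation O) {x y : A} (H : O 0 x y) (hy : O 0 y (y + y)) :
    O 0 x (x + x) :=
  h.lt_double_iff.2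
    (h.trans_zero H (h.trans_zero (h.lt_double_iff.1 hy) (h.neg_lt_neg H)))

/-- Both doubles are compared with `x + y`. On the first half circle, translating `(0, x, y)` by `x`
or by `y` does not carry it past `0`. -/
theorem double_lt_double (h : IsOrientation O) {x y : A} (H : O 0 x y) (hy : O 0 y (y + y)) :
    O 0 (x + x) (y + y) := by
  have hy' := h.lt_double_iff.1 hy
  have a₁ : O x (x + x) (x + y) := h.translate x H (by abel) (by abel) (by abel)
  have a₂ : O x (x + y) 0 :=
    h.translate x (h.trans_zero hy' (h.neg_lt_neg H)) (by abel) (by abel) (by abel)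
  have b₁ : O y (x + y) (y + y) := h.translate y H (by abel) (by abel) (by abel)
  have b₂ : O y (y + y) 0 := h.translate y hy' (by abel) (by abel) (by abel)
  exact h.trans_zero (h.cyclic' (h.trans_right a₁ a₂)) (h.cyclic' (h.trans_right b₁ b₂))

/-- On the second half circle the same translations pass `0` before reaching any of the points
compared, so the order survives. -/
theorem double_lt_double_of_neg_lt (h : IsOrientation O) {x y : A} (H : O 0 x y)
    (hx : O 0 (-x) x) : O 0 (x + x) (y + y) := by
  have a₁ : O x (x + x) (x + y) := h.translate x H (by abel) (by abel) (by abel)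
  have a₂ : O x 0 (x + x) := h.translate x hx (by abel) (by abel) (by abel)
  have b₁ : O y (x + y) (y + y) := h.translate y H (by abel) (by abel) (by abel)
  have b₂ : O y 0 (x + y) :=
    h.translate y (h.trans_zero (h.neg_lt_neg H) hx) (by abel) (by abel) (by abel)
  exact h.trans_zero (h.trans_right a₂ a₁) (h.trans_right b₂ b₁)

/-- If `2 • y` does not lie beyond `y`, then `-y` lies below `y` unless `2 • y = 0`. -/
theorem neg_lt_of_not_lt_double (h : IsOrientation O) {y : A} (hy : ¬ O 0 y (y + y))
    (hy' : y + y ≠ 0) : O 0 (-y) y := by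
  have hy₀ : y ≠ 0 := by
    rintro rfl
    simp at hy'
  refine (h.total_zero hy₀ (neg_ne_zero.2 hy₀) fun e => hy' ?_).resolve_left
    (fun H => hy (h.lt_double_iff.2 H))
  rw [← eq_neg_iff_add_eq_zero]
  exact e

/-! The traces of the intervals `(y, 2y)`. -/

theorem mem_interval_iff_of_lt_double (h : IsOrientation O) {x y : A} (hy : O 0 y (y + y)) :
    O y x (y + y) ↔ O 0 y x ∧ O 0 x (y + y) :=
  ⟨fun H => h.between_zero hy H, fun H => h.trans_right H.1 H.2⟩

theorem mem_interval_iff_of_not_lt_double (h : IsOrientation O) {x y : A} (hy₀ : y ≠ 0)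
    (hy : ¬ O 0 y (y + y)) :
    O y x (y + y) ↔ O 0 y x ∨ (y + y ≠ 0 ∧ (x = 0 ∨ O 0 x (y + y))) := by
  by_cases h2 : y + y = 0
  · rw [h2]
    simp only [ne_eq, not_true_eq_false, false_and, or_false]
    exact ⟨h.cyclic' , h.cyclic _ _ _⟩
  · have H : O y 0 (y + y) :=
      h.translate y (h.neg_lt_of_not_lt_double hy h2) (by abel) (by abel) (by abel)
    simp only [ne_eq, h2, not_false_eq_true, true_and]
    constructor
    · intro Hx
      by_cases hx : x = 0
      · exact .inr (.inl hx)
      · rcases h.total_zero hy₀ hx (h.strict _ _ _ Hx).1 with h₁ | h₁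
        · exact .inl h₁
        · exact .inr (.inr (h.trans_right (h.cyclic' h₁) Hx))
    · rintro (h₁ | rfl | h₁)
      · exact h.trans_left (h.cyclic _ _ _ h₁) H
      · exact H
      · exact h.cyclic _ _ _ (h.trans_left (h.cyclic' H) (h.cyclic' h₁))

end IsOrientation
-- Quadratic upper bound for the shatter function.
section Upper

variable {A : Type*} [AddCommGroup A] {O : A → A → A → Prop}

open Finset in
open scoped Classical in
/-- The intervals `(y, 2y)` have linearly many traces on finite sets. -/
theorem IsOrientation.ncard_interval_traces_le (h : IsOrientation O) {X : Type*} (v : X → A)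
    (B : Finset X) :
    (Set.range fun y : A => {x ∈ B | O y (v x) (y + y)}).ncard ≤ 4 * #B + 3 := by
  -- `f` records the points not beyond `y`, rather than those beyond it, so that `f` and `g` both
  -- grow with `y`. When `2y = 0` the interval stops at `0`, hence `g y` is empty.
  let f (y : A) : Finset X := {x ∈ B | ¬ O 0 y (v x)}
  let g (y : A) : Finset X := {x ∈ B | y + y ≠ 0 ∧ (v x = 0 ∨ O 0 (v x) (y + y))}
  let S₁ : Set A := {y | O 0 y (y + y)}
  let S₂ : Set A := {y | y ≠ 0 ∧ ¬ O 0 y (y + y)}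
  have mono : ∀ y y', O 0 y y' → (y + y ≠ 0 → y' + y' ≠ 0 ∧ O 0 (y + y) (y' + y')) →
      f y ⊆ f y' ∧ g y ⊆ g y' := by
    intro y y' hy hyy
    refine ⟨fun x hx => ?_, fun x hx => ?_⟩
    · simp only [f, mem_filter] at hx ⊢
      exact ⟨hx.1, fun H => hx.2 (h.trans_zero hy H)⟩
    · simp only [g, mem_filter] at hx ⊢
      obtain ⟨h₁, h₂⟩ := hyy hx.2.1
      exact ⟨hx.1, h₁, hx.2.2.imp_right fun H => h.trans_zero H h₂⟩
  have chain : ∀ S : Set A, (∀ y ∈ S, y ≠ 0) →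
      (∀ y ∈ S, ∀ y' ∈ S, O 0 y y' → y + y ≠ 0 → O 0 (y + y) (y' + y')) →
      ∀ y ∈ S, ∀ y' ∈ S, (f y ⊆ f y' ∧ g y ⊆ g y') ∨ (f y' ⊆ f y ∧ g y' ⊆ g y) := by
    intro S hS hmono y hy y' hy'
    by_cases e : y = y'
    · subst e
      exact .inl ⟨subset_rfl, subset_rfl⟩
    have key : ∀ y ∈ S, ∀ y' ∈ S, O 0 y y' → f y ⊆ f y' ∧ g y ⊆ g y' :=
      fun y hy y' hy' H => mono y y' H fun H' =>
        have := hmono y hy y' hy' H H'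
        ⟨(h.strict _ _ _ this).2.2.symm, this⟩
    exact (h.total_zero (hS y hy) (hS y' hy') e).imp (key y hy y' hy') (key y' hy' y hy)
  have chain₁ := chain S₁ (fun y hy => (h.strict _ _ _ hy).1.symm)
    (fun y _ y' hy' H _ => h.double_lt_double H hy')
  have chain₂ := chain S₂ (fun y hy => hy.1)
    (fun y hy y' _ H H' => h.double_lt_double_of_neg_lt H (h.neg_lt_of_not_lt_double hy.2 H'))
  have hf : ∀ y, f y ⊆ B := fun y => filter_subset _ _
  have hg : ∀ y, g y ⊆ B := fun y => filter_subset _ _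
  obtain ⟨fin₁, card₁⟩ := ncard_image_le_of_chain B S₁ f g hf hg chain₁
    -- Before the half turn, `(y, 2y)` is the part beyond `y` and below `2y`; after it the interval
    -- wraps round `0`, and the intersection becomes a union.
    (fun s t => (B \ s) ∩ t)
  obtain ⟨fin₂, card₂⟩ := ncard_image_le_of_chain B S₂ f g hf hg chain₂
    (fun s t => (B \ s) ∪ t)
  -- The extra `∅` accounts for `y = 0`.
  have sub : (Set.range fun y : A => {x ∈ B | O y (v x) (y + y)}) ⊆
      insert ∅ (((fun y => (B \ f y) ∩ g y) '' S₁) ∪ ((fun y => (B \ f y) ∪ g y) '' S₂)) := by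
    rintro _ ⟨y, rfl⟩
    by_cases hy₀ : y = 0
    · left
      ext x
      simp only [mem_filter, notMem_empty, iff_false, not_and, hy₀, add_zero]
      exact fun _ H => (h.strict _ _ _ H).2.2 rfl
    right
    by_cases hy : O 0 y (y + y)
    · left
      refine ⟨y, hy, ?_⟩
      ext x
      have h2 : y + y ≠ 0 := (h.strict _ _ _ hy).2.2.symm
      have h3 : O 0 y (v x) → v x ≠ 0 := fun H => (h.strict _ _ _ H).2.2.symm
      simp only [f, g, mem_inter, Finset.mem_sdiff, mem_filter, h.mem_interval_iff_of_lt_double hy]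
      tauto
    · right
      refine ⟨y, ⟨hy₀, hy⟩, ?_⟩
      ext x
      simp only [f, g, mem_union, Finset.mem_sdiff, mem_filter,
        h.mem_interval_iff_of_not_lt_double hy₀ hy]
      tauto
  calc _ ≤ _ := Set.ncard_le_ncard sub ((fin₁.union fin₂).insert _)
    _ ≤ _ := Set.ncard_insert_le _ _
    _ ≤ _ := Nat.add_le_add_right (Set.ncard_union_le _ _) 1
    _ ≤ _ := by omega

open Finset in
open scoped Classical in
/-- The cosets of a subgroup have at most `n + 1` traces on an `n`-element set. -/
theorem ncard_coset_traces_le (G : AddSubgroup A) {X : Type*} (v : X → A) (B : Finset X) :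
    (Set.range fun y : A => {x ∈ B | v x - y ∈ G}).ncard ≤ #B + 1 := by
  have sub : (Set.range fun y : A => {x ∈ B | v x - y ∈ G}) ⊆
      ((insert ∅ (B.image fun z => {x ∈ B | v x - v z ∈ G}) : Finset (Finset X)) :
        Set (Finset X)) := by
    rintro _ ⟨y, rfl⟩
    simp only [coe_insert, coe_image]
    rcases eq_empty_or_nonempty {x ∈ B | v x - y ∈ G} with H | ⟨z, hz⟩
    · exact .inl H
    · rw [mem_filter] at hz
      -- A nonempty trace is that of the coset of any of its points.
      refine .inr ⟨z, hz.1, filter_congr fun x _ => ?_⟩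
      rw [← G.add_mem_cancel_right (y := v x - v z) hz.2, sub_add_sub_cancel]
  calc _ ≤ _ := Set.ncard_le_ncard sub (Finset.finite_toSet _)
    _ = _ := Set.ncard_coe_finset _
    _ ≤ _ := (card_insert_le _ _).trans (Nat.add_le_add_right card_image_le 1)

open Finset in
open scoped Classical in
/-- The shatter function of `σ` grows at most quadratically. -/
theorem IsOrientation.shatterFunction_sigmaFormula_le (h : IsOrientation O) (G : AddSubgroup A)
    (n : ℕ) :
    letI := pairStructure O G
    shatterFunction (formulaFamily A sigmaFormula) n ≤ (4 * n + 3) * (n + 1) := by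
  let _ := pairStructure O G
  have finite_range : ∀ (B : Finset (Fin 1 → A)) (P : A → (Fin 1 → A) → Prop),
      (Set.range fun y : A => {x ∈ B | P y x}).Finite := fun B P =>
    B.powerset.finite_toSet.subset (by
      rintro _ ⟨y, rfl⟩
      exact mem_coe.2 (mem_powerset.2 (filter_subset _ _)))
  refine csSup_le' ?_
  rintro _ ⟨B, rfl, rfl⟩
  let I := Set.range fun y : A => {x ∈ B | O y (x 0) (y + y)}
  let C := Set.range fun y : A => {x ∈ B | x 0 - y ∈ G}
  have hI : I.Finite := finite_range B fun y x => O y (x 0) (y + y)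
  have hC : C.Finite := finite_range B fun y x => x 0 - y ∈ G
  have sub : traces (formulaFamily A sigmaFormula) B ⊆
      (fun p : Finset (Fin 1 → A) × Finset (Fin 1 → A) => ((p.1 ∪ p.2 : Finset _) : Set _)) ''
        (I ×ˢ C) := by
    rintro _ ⟨_, ⟨b, rfl⟩, rfl⟩
    refine ⟨({x ∈ B | O (b 0) (x 0) (b 0 + b 0)}, {x ∈ B | x 0 - b 0 ∈ G}),
      ⟨⟨b 0, rfl⟩, ⟨b 0, rfl⟩⟩, ?_⟩
    ext x
    simp only [mem_coe, mem_union, mem_filter, Set.mem_inter_iff,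
      mem_definedSet_sigmaFormula, two_nsmul]
    tauto
  calc _ ≤ _ := Set.ncard_le_ncard sub ((hI.prod hC).image _)
    _ ≤ _ := Set.ncard_image_le (hI.prod hC)
    _ = I.ncard * C.ncard := Set.ncard_prod
    _ ≤ _ := Nat.mul_le_mul (h.ncard_interval_traces_le (fun x : Fin 1 → A => x 0) B)
      (ncard_coset_traces_le G (fun x : Fin 1 → A => x 0) B)

end Upper

/-! ### Points near `0` and the sequence for the lower bound. -/

section Lower

variable {A : Type*} [AddCommGroup A] {O : A → A → A → Prop}

theorem IsRegularlyDense.exists_double (hd : IsRegularlyDense O) {a b : A} (hab : O 0 a b) :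
    ∃ c, O a (c + c) b ∧ O 0 c (c + c) := by
  obtain ⟨c, hc, hi⟩ := hd 2 Nat.prime_two a b hab
  have := (hi 1 (by simp)).2
  rw [one_nsmul, one_add_one_eq_two] at this
  rw [two_nsmul] at hc this
  exact ⟨c, hc, this⟩

theorem exists_between_zero (h : IsOrientation O) (hd : IsRegularlyDense O)
    [Infinite A] {b : A} (hb : b ≠ 0) : ∃ z, O 0 z b := by
  obtain ⟨a, ha⟩ := (Set.toFinite {0, b}).exists_notMem
  simp only [Set.mem_insert_iff, Set.mem_singleton_iff, not_or] at ha
  rcases h.total_zero ha.1 hb ha.2 with H | H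
  · exact ⟨a, H⟩
  -- Regular density does not apply to an interval starting at `0`, so `(0, b)` is first translated
  -- by `-a`.
  · obtain ⟨c, hc, -⟩ := hd.exists_double (h.neg_lt_sub H)
    exact ⟨c + c + a, h.translate a hc (by abel) rfl (by abel)⟩

theorem exists_between (h : IsOrientation O) (hd : IsRegularlyDense O)
    [Infinite A] {a b : A} (hab : a ≠ b) : ∃ z, O a z b := by
  obtain ⟨z, hz⟩ := exists_between_zero h hd (sub_ne_zero.2 hab.symm)
  exact ⟨z + a, h.translate a hz (by abel) rfl (by abel)⟩

theorem exists_mem_coset_between (h : IsOrientation O) (hd : IsRegularlyDense O)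
    [Infinite A] {G : AddSubgroup A}
    (hG : ∀ a b : A, {x | O a x b}.Nonempty → ∃ g ∈ G, O a g b) {a b : A} (hab : a ≠ b) (t : A) :
    ∃ x, O a x b ∧ x - t ∈ G := by
  obtain ⟨z, hz⟩ := exists_between h hd (sub_left_injective.ne hab : a - t ≠ b - t)
  obtain ⟨g, hg, hg'⟩ := hG _ _ ⟨z, hz⟩
  exact ⟨g + t, h.translate t hg' (by abel) rfl (by abel), by simpa using hg⟩

theorem exists_double_lt (h : IsOrientation O) (hd : IsRegularlyDense O)
    [Infinite A] {u : A} (hu : u ≠ 0) :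
    ∃ c, O 0 c (c + c) ∧ O 0 (c + c) u := by
  obtain ⟨z, hz⟩ := exists_between_zero h hd hu
  obtain ⟨c, hc, hc'⟩ := hd.exists_double hz
  exact ⟨c, hc', (h.between_zero hz hc).2⟩

/-- Arbitrarily close to `0` there is a point `x` in a prescribed coset, and an interval `(c, x)`
such that all `b` in this interval satisfy `b < x < 2b`, with `2b` still close to `0`. -/
theorem exists_isolated_point (h : IsOrientation O) (hd : IsRegularlyDense O)
    [Infinite A] {G : AddSubgroup A}
    (hG : ∀ a b : A, {x | O a x b}.Nonempty → ∃ g ∈ G, O a g b) {u : A} (hu : u ≠ 0) (t : A) :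
    ∃ c x, c ≠ 0 ∧ x - t ∈ G ∧ O 0 c x ∧ O 0 x u ∧
      ∀ b, O c b x → O b x (b + b) ∧ O 0 c b ∧ O 0 b (b + b) ∧ O 0 (b + b) u := by
  -- With `c < x < 2c < c₁` and `2c₁ < u`, every `b` in `(c, x)` satisfies `x < 2c < 2b < 2c₁ < u`.
  obtain ⟨c₁, hc₁, hc₁u⟩ := exists_double_lt h hd hu
  obtain ⟨c, hc, hcc₁⟩ := exists_double_lt h hd (h.strict _ _ _ hc₁).1.symm
  obtain ⟨x, hx, hxt⟩ := exists_mem_coset_between h hd hG (h.strict _ _ _ hc).2.1 t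
  obtain ⟨hcx, hxc⟩ := h.between_zero hc hx
  have hxc₁ := h.trans_zero hxc hcc₁
  refine ⟨c, x, (h.strict _ _ _ hc).1.symm, hxt, hcx,
    h.trans_zero hxc₁ (h.trans_zero hc₁ hc₁u), fun b hb => ?_⟩
  obtain ⟨hcb, hbx⟩ := h.between_zero hcx hb
  have hbc₁ := h.trans_zero hbx hxc₁
  have hbb := h.lt_double_of_lt hbc₁ hc₁
  refine ⟨?_, hcb, hbb, h.trans_zero (h.double_lt_double hbc₁ hc₁) hc₁u⟩
  exact h.trans_right hbx (h.trans_zero hxc (h.double_lt_double hcb hbb))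

/-- There is a sequence such that `σ` cuts out all its subsets of size one or two. -/
theorem exists_sequence (h : IsOrientation O) (hd : IsRegularlyDense O)
    {G : AddSubgroup A} [Infinite (A ⧸ G)]
    (hG : ∀ a b : A, {x | O a x b}.Nonempty → ∃ g ∈ G, O a g b) :
    ∃ x : ℕ → A, Function.Injective x ∧
      ∀ n j, ∃ b, ∀ m, (O b (x m) (b + b) ∨ x m - b ∈ G) ↔ m = n ∨ m = j := by
  have : Infinite A := Infinite.of_surjective _ (QuotientAddGroup.mk_surjective (s := G))
  let t (n : ℕ) : A := (Infinite.natEmbedding (A ⧸ G) n).out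
  have ht : ∀ m n, t m - t n ∈ G → m = n := by
    intro m n H
    apply (Infinite.natEmbedding (A ⧸ G)).injective
    rw [← QuotientAddGroup.out_eq' (Infinite.natEmbedding (A ⧸ G) m),
      ← QuotientAddGroup.out_eq' (Infinite.natEmbedding (A ⧸ G) n)]
    exact (QuotientAddGroup.eq_iff_sub_mem).2 H
  obtain ⟨u₀, hu₀⟩ := exists_ne (0 : A)
  choose! cf xf hc hxt hcx hxu hb using
    fun (u : A) (hu : u ≠ 0) (s : A) => exists_isolated_point h hd hG hu s
  -- The barriers `c n` interlace with the points: `c (n + 1) < x n < c n`.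
  let c (n : ℕ) : A := Nat.rec u₀ (fun n u => cf u (t n)) n
  have hc₀ : ∀ n, c n ≠ 0 := fun n => by
    induction n with
    | zero => exact hu₀
    | succ n ih => exact hc _ ih (t n)
  let x (n : ℕ) : A := xf (c n) (t n)
  have hxt : ∀ n, x n - t n ∈ G := fun n => hxt _ (hc₀ n) (t n)
  have hcx : ∀ n, O 0 (c (n + 1)) (x n) := fun n => hcx _ (hc₀ n) (t n)
  have hxc : ∀ n, O 0 (x n) (c n) := fun n => hxu _ (hc₀ n) (t n)
  have hanti : ∀ n m, n < m → O 0 (x m) (c (n + 1)) := by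
    intro n m hnm
    induction m, hnm using Nat.le_induction with
    | base => exact hxc (n + 1)
    | succ m _ ih => exact h.trans_zero (hxc (m + 1)) (h.trans_zero (hcx m) ih)
  refine ⟨x, ?_, fun n j => ?_⟩
  · intro m n hmn
    apply ht
    have h₁ := hxt n
    rw [← hmn] at h₁
    have := G.sub_mem h₁ (hxt m)
    rwa [sub_sub_sub_cancel_left] at this
  -- Since `c (n + 1) < b < x n < 2b < c n`, the interval `(b, 2b)` selects `x n` alone; the coset
  -- of `b` selects `x j`.
  · obtain ⟨b, hb₁, hbt⟩ := exists_mem_coset_between h hd hG (h.strict _ _ _ (hcx n)).2.1 (t j)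
    obtain ⟨h₁, h₂, h₃, h₄⟩ := hb _ (hc₀ n) (t n) b hb₁
    refine ⟨b, fun m => or_congr ⟨fun H => ?_, ?_⟩ ⟨fun H => ht _ _ ?_, ?_⟩⟩
    · obtain ⟨H₁, H₂⟩ := h.between_zero h₃ H
      rcases lt_trichotomy m n with hmn | hmn | hmn
      · obtain ⟨k, rfl⟩ := Nat.exists_eq_add_of_lt hmn
        have hle : ∀ k, O 0 (c (m + k + 1)) (x m) := fun k => by
          induction k with
          | zero => exact hcx m
          | succ k ih =>
            exact h.trans_zero (hcx (m + (k + 1))) (h.trans_zero (hxc (m + k + 1)) ih)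
        exact (h.asymm_zero H₂ (h.trans_zero h₄ (hle k))).elim
      · exact hmn
      · exact (h.asymm_zero H₁ (h.trans_zero (hanti n m hmn) h₂)).elim
    · rintro rfl
      exact h₁
    · have := G.sub_mem (G.add_mem H hbt) (hxt m)
      convert this using 1
      abel
    · rintro rfl
      have := G.sub_mem (hxt m) hbt
      convert this using 1
      abel

end Lower

/-! ### From bounds on the shatter function to VC-density. -/

section Density

variable {X : Type*} {S : Set (Set X)}

theorem setVCDensity_le_two {C : ℕ} (hS : ∀ n, shatterFunction S n ≤ (C * n + C) * (n + 1)) :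
    setVCDensity S ≤ 2 := by
  refine iInf₂_le (2 : ℝ≥0) ?_
  refine IsBigO.of_bound (4 * C : ℝ) ?_
  filter_upwards [eventually_ge_atTop 1] with n hn
  have h₁ : shatterFunction S n ≤ 4 * C * n ^ 2 := by
    refine (hS n).trans ?_
    calc (C * n + C) * (n + 1) ≤ (C * n + C * n) * (n + n) := by gcongr; nlinarith
      _ = 4 * C * n ^ 2 := by ring
  have h₂ : (shatterFunction S n : ℝ) ≤ 4 * C * n ^ 2 := by exact_mod_cast h₁
  simpa using h₂

open Finset in
/-- If every subset of size at most two of `B` is a trace, then there are at least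
`(#B).choose 2` traces. -/
theorem choose_two_le_shatterFunction {B : Finset X}
    (hB : ∀ T ⊆ B, #T ≤ 2 → ∃ s ∈ S, s ∩ (B : Set X) = T) :
    (#B).choose 2 ≤ shatterFunction S #B := by
  refine le_trans ?_ (le_csSup (bddAbove_traces S #B) ⟨B, rfl, rfl⟩)
  have hfin : (traces S B).Finite := B.finite_toSet.finite_subsets.subset (by
    rintro _ ⟨s, -, rfl⟩
    exact Set.inter_subset_right)
  have sub : (fun T : Finset X => (T : Set X)) '' (powersetCard 2 B : Set (Finset X)) ⊆
      traces S B := by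
    rintro _ ⟨T, hT, rfl⟩
    rw [mem_coe, mem_powersetCard] at hT
    exact hB T hT.1 hT.2.le
  have := Set.ncard_le_ncard sub hfin
  rwa [Set.ncard_image_of_injective _ coe_injective, Set.ncard_coe_finset,
    card_powersetCard] at this

theorem two_le_setVCDensity (hS : ∀ n, n.choose 2 ≤ shatterFunction S n) :
    2 ≤ setVCDensity S := by
  refine le_iInf₂ fun r hr => ?_
  by_contra! hlt
  have hr2 : (r : ℝ) < 2 := by exact_mod_cast hlt
  have hsq : (fun n : ℕ => (n : ℝ) ^ (2 : ℝ)) =O[atTop] fun n : ℕ => (n : ℝ) ^ (r : ℝ) := by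
    refine IsBigO.trans (IsBigO.of_bound 4 ?_) hr
    filter_upwards [eventually_ge_atTop 2] with n hn
    -- `4 * n.choose 2 = 2n(n - 1)`, which is at least `n ^ 2` once `n ≥ 2`.
    have h₁ : n ^ 2 ≤ 4 * shatterFunction S n := by
      have h₃ := hS n
      have h₄ := Nat.div_mul_cancel (Nat.even_mul_pred_self n).two_dvd
      rw [Nat.choose_two_right] at h₃
      obtain ⟨m, rfl⟩ : ∃ m, n = m + 1 := ⟨n - 1, by omega⟩
      simp only [Nat.add_sub_cancel] at h₃ h₄
      nlinarith
    have h₂ : (n : ℝ) ^ 2 ≤ 4 * shatterFunction S n := by exact_mod_cast h₁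
    simpa using h₂
  have hlo : (fun n : ℕ => (n : ℝ) ^ (r : ℝ)) =o[atTop] fun n : ℕ => (n : ℝ) ^ (2 : ℝ) := by
    refine isLittleO_of_tendsto' ?_ ?_
    · filter_upwards [eventually_ge_atTop 1] with n hn h0
      have : (0 : ℝ) < (n : ℝ) ^ (2 : ℝ) := Real.rpow_pos_of_pos (by exact_mod_cast hn) _
      exact (this.ne' h0).elim
    · refine ((tendsto_rpow_neg_atTop (sub_pos.2 hr2)).comp
        tendsto_natCast_atTop_atTop).congr' ?_
      filter_upwards [eventually_ge_atTop 1] with n hn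
      rw [Function.comp_apply, neg_sub, Real.rpow_sub (by exact_mod_cast hn)]
  refine hsq.not_isLittleO ?_ hlo
  refine (eventually_ge_atTop 1).frequently.mono fun n hn => ?_
  exact (Real.rpow_pos_of_pos (by exact_mod_cast hn) _).ne'

end Density

/-! ### Cutting out small subsets, and the density of `σ`. -/

open Finset in
/-- For every `k` there are `k` points all of whose subsets of size at most two are cut out
by `σ`. -/
theorem exists_finset_cut_by_sigmaFormula {A : Type*} [AddCommGroup A] {O : A → A → A → Prop}
    {G : AddSubgroup A} {d₁ e₁ d₂ e₂ : Nat.Primes → ℕ∞} (h : IsPairModel O G d₁ e₁ d₂ e₂)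
    (k : ℕ) :
    letI := pairStructure O G
    ∃ B : Finset (Fin 1 → A), #B = k ∧ ∀ T ⊆ B, #T ≤ 2 →
      ∃ b : Fin 1 → A, definedSet A sigmaFormula b ∩ (B : Set (Fin 1 → A)) = T := by
  classical
  have := h.infinite
  obtain ⟨x, hx, hcut⟩ := exists_sequence h.model.orientation h.model.regularlyDense h.dense
  let v (m : ℕ) : Fin 1 → A := fun _ => x m
  have hv : Function.Injective v := fun m n e => hx (congrFun e 0)
  refine ⟨(range k).image v, by rw [card_image_of_injective _ hv, card_range], fun T hT hT2 => ?_⟩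
  obtain ⟨U, hU, rfl⟩ := subset_image_iff.1 hT
  rw [card_image_of_injective _ hv] at hT2
  obtain ⟨n, j, hnj⟩ : ∃ n j, ∀ m < k, (m = n ∨ m = j) ↔ m ∈ U := by
    interval_cases hc : #U
    · rw [card_eq_zero] at hc
      -- The index `k` lies outside `range k`, so the set cut out misses all the chosen points.
      refine ⟨k, k, fun m hm => ?_⟩
      simp [hc, hm.ne]
    · obtain ⟨n, rfl⟩ := card_eq_one.1 hc
      exact ⟨n, n, fun m _ => by simp⟩
    · obtain ⟨n, j, -, rfl⟩ := card_eq_two.1 hc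
      exact ⟨n, j, fun m _ => by simp⟩
  obtain ⟨b, hb⟩ := hcut n j
  refine ⟨fun _ => b, ?_⟩
  ext a
  rw [Set.mem_inter_iff, mem_definedSet_sigmaFormula, two_nsmul]
  simp only [coe_image, Set.mem_image, mem_coe]
  constructor
  · rintro ⟨ha, m, hm, rfl⟩
    exact ⟨m, (hnj m (mem_range.1 hm)).1 ((hb m).1 ha), rfl⟩
  · rintro ⟨m, hm, rfl⟩
    exact ⟨(hb m).2 ((hnj m (mem_range.1 (hU hm))).2 hm), m, hU hm, rfl⟩

theorem IsPairModel.vcDensity_sigmaFormula {A : Type*} [AddCommGroup A] {O : A → A → A → Prop}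
    {G : AddSubgroup A} {d₁ e₁ d₂ e₂ : Nat.Primes → ℕ∞} (h : IsPairModel O G d₁ e₁ d₂ e₂) :
    letI := pairStructure O G
    vcDensity A sigmaFormula = 2 := by
  let _ := pairStructure O G
  refine le_antisymm (setVCDensity_le_two (C := 4) fun n => ?_)
    (two_le_setVCDensity fun n => ?_)
  · exact (h.model.orientation.shatterFunction_sigmaFormula_le G n).trans (by gcongr; omega)
  · obtain ⟨B, rfl, hB⟩ := exists_finset_cut_by_sigmaFormula h n
    refine choose_two_le_shatterFunction fun T hT hT2 => ?_
    obtain ⟨b, hb⟩ := hB T hT hT2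
    exact ⟨_, ⟨b, rfl⟩, hb⟩

end OrientedPairs

theorem mainTheorem4 {A : Type*} [AddCommGroup A] (O : A → A → A → Prop) (G : AddSubgroup A)
    (h : OrientedPairs.IsPairModel O G (fun _ => 0) (fun _ => 0) (fun _ => 0) (fun _ => 0) ∨
      OrientedPairs.IsPairModel O G (fun _ => 0) (fun _ => ⊤) (fun _ => 0) (fun _ => 0) ∨
      OrientedPairs.IsPairModel O G (fun _ => 0) (fun _ => ⊤) (fun _ => 0) (fun _ => ⊤)) :
    letI : OrientedPairs.pairLanguage.Structure A := OrientedPairs.pairStructure O G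
    -- the VC-density of `σ` is exactly `2`
    OrientedPairs.vcDensity A OrientedPairs.sigmaFormula = 2 ∧
    -- no uniform bound `c * |y|` with `c < 2` holds for all partitioned formulas
    (∀ c : ENNReal,
      (∀ (m n : ℕ) (ψ : OrientedPairs.pairLanguage.Formula (Fin m ⊕ Fin n)),
        OrientedPairs.vcDensity A ψ ≤ c * n) → 2 ≤ c) ∧
    -- for every `k`, there are `k` points all of whose subsets of size `≤ 2` are cut out by `σ`
    (∀ k : ℕ, ∃ B : Finset (Fin 1 → A), B.card = k ∧
      ∀ T : Finset (Fin 1 → A), T ⊆ B → T.card ≤ 2 →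
        ∃ b : Fin 1 → A,
          OrientedPairs.definedSet A OrientedPairs.sigmaFormula b ∩ (B : Set (Fin 1 → A)) = T) := by
  obtain ⟨d₁, e₁, d₂, e₂, h⟩ : ∃ d₁ e₁ d₂ e₂, OrientedPairs.IsPairModel O G d₁ e₁ d₂ e₂ := by
    rcases h with h | h | h <;> exact ⟨_, _, _, _, h⟩
  refine ⟨h.vcDensity_sigmaFormula, fun c hc => ?_, fun k => ?_⟩
  · simpa [h.vcDensity_sigmaFormula] using hc 1 1 OrientedPairs.sigmaFormula
  · exact OrientedPairs.exists_finset_cut_by_sigmaFormula h k
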